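/- Let $F$ be a field with $\operatorname{char} F \neq 2$, let $n \ge 3$ and $1 \le k \le n-1$. The permanental rank $\operatorname{prk}(A)$ of a matrix $A \in M_n(F)$ is the largest $r$ such that $A$ has an $r \times r$ submatrix with nonzero permanent (it is $0$ for $A = 0$), and $\Lambda^{\le k} = \{A \in M_n(F) : \operatorname{prk}(A) \le k\}$. For a permutation $\sigma \in S_n$ let $P(\sigma) \in M_n(F)$ be the permutation matrix whose $(i,j)$ entry is $1$ if $j = \sigma^{-1}(i)$ and $0$ otherwise. Let $T : M_n(F) \to M_n(F)$ be a bijective linear map. Then $T(\Lambda^{\le k}) \subseteq \Lambda^{\le k}$ if and only if there exist permutations $\sigma_1, \sigma_2 \in S_n$ and diagonal matrices $D_1, D_2 \in M_n(F)$ with nonzero diagonal entries such that either $$T(A) = D_1 P(\sigma_1) A P(\sigma_2) D_2 \quad \text{for all } A \in M_n(F),$$ or $$T(A) = D_1 P(\sigma_1) A^{T} P(\sigma_2) D_2 \quad \text{for all } A \in M_n(F).$$ -/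

import Mathlib

/-- The permanental rank of a square matrix `A`: the largest size `r` of an `r × r` submatrix of
`A` (given by increasing choices of `r` rows and `r` columns) whose permanent is nonzero. The
empty submatrix has permanent `1`, so the zero matrix has permanental rank `0`. -/
noncomputable def permanentalRank {F : Type*} [Field F] {n : ℕ}
    (A : Matrix (Fin n) (Fin n) F) : ℕ :=
  sSup {r : ℕ | ∃ f g : Fin r ↪o Fin n, (A.submatrix f g).permanent ≠ 0}

/-- The supremum defining the permanental rank is a maximum. -/
theorem permanentalRank_isGreatest {F : Type*} [Field F] {n : ℕ}
    (A : Matrix (Fin n) (Fin n) F) :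
    IsGreatest {r : ℕ | ∃ f g : Fin r ↪o Fin n, (A.submatrix f g).permanent ≠ 0}
      (permanentalRank A) := by
  have hb : BddAbove {r : ℕ | ∃ f g : Fin r ↪o Fin n, (A.submatrix f g).permanent ≠ 0} := by
    refine ⟨n, ?_⟩
    rintro r ⟨f, -, -⟩
    simpa using Fintype.card_le_of_injective f f.injective
  have hne : {r : ℕ | ∃ f g : Fin r ↪o Fin n, (A.submatrix f g).permanent ≠ 0}.Nonempty :=
    ⟨0, Fin.castLEOrderEmb (Nat.zero_le n), Fin.castLEOrderEmb (Nat.zero_le n), by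
      simp [Matrix.permanent]⟩
  exact ⟨Nat.sSup_mem hne hb, fun r hr => le_csSup hb hr⟩

/-- The set of `n × n` matrices over `F` of permanental rank at most `k`. -/
def permRankLE (F : Type*) [Field F] (n k : ℕ) : Set (Matrix (Fin n) (Fin n) F) :=
  {A | permanentalRank A ≤ k}

/-- The permutation matrix `P(σ)`, whose `(i, j)` entry is `1` if `j = σ⁻¹ i` and `0` otherwise. -/
def permutationMatrix (F : Type*) [Field F] {n : ℕ} (σ : Equiv.Perm (Fin n)) :
    Matrix (Fin n) (Fin n) F :=
  Matrix.of fun i j => if j = σ⁻¹ i then 1 else 0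

/-! The argument studies subspaces $W \subseteq \Lambda^{\le k}$ of dimension $kn$. The positions of
the lexicographically first nonzero entries of matrices in $W$ number at least $\dim W$, and $k+1$
of them in distinct rows and columns would produce a nonzero permanental minor in $W$. Hall's
theorem then forces these positions to be $k$ full rows or $k$ full columns. Thus $W$ is a graph
over those entries, and `lift_apply_eq_zero`, where $\operatorname{char} F \ne 2$ and $n \ge 3$
enter, shows that all other entries vanish (`eq_supportedMatrices_of_finrank_eq`).

Hence $T$ sends each space of matrices supported on $k$ rows or $k$ columns to a coordinate
subspace. Those containing a matrix unit intersect in the line it spans, so $T$ is monomial in the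
matrix units. Testing $T$ on matrices with $k+1$ nonzero entries shows that the induced map of cells
preserves collinearity, hence permutes rows and columns up to transposition. A block of zero
permanent makes the coefficient matrix rank one, which gives $D_1$ and $D_2$. -/

namespace Matrix

/-! ### Permanents -/

section Permanent

variable {ι m R : Type*} [Fintype ι] [DecidableEq ι] [Fintype m] [DecidableEq m] [CommSemiring R]

theorem permanent_submatrix_equiv (M : Matrix m m R) (e e' : ι ≃ m) :
    (M.submatrix e e').permanent = M.permanent := by
  have h : M.submatrix e e' = (M.submatrix (e'.symm.trans e) id).submatrix e' e' := by
    ext i j; simp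
  have h' (N : Matrix m m R) : (N.submatrix e' e').permanent = N.permanent := by
    unfold permanent
    refine Fintype.sum_equiv (Equiv.permCongr e') _ _ fun σ => ?_
    refine Fintype.prod_equiv e' _ _ fun i => ?_
    simp
  rw [h, h', permanent_permute_cols]

theorem permanent_eq_zero_of_row_eq_zero (M : Matrix m m R) (i : m) (h : ∀ j, M i j = 0) :
    M.permanent = 0 :=
  Finset.sum_eq_zero fun σ _ =>
    Finset.prod_eq_zero (Finset.mem_univ (σ⁻¹ i)) (by simp [h])

theorem permanent_eq_zero_of_col_eq_zero (M : Matrix m m R) (j : m) (h : ∀ i, M i j = 0) :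
    M.permanent = 0 := by
  rw [← permanent_transpose]
  exact permanent_eq_zero_of_row_eq_zero _ j h

theorem permanent_mul_row_col (M : Matrix m m R) (u v : m → R) :
    (of fun i j => u i * M i j * v j).permanent = (∏ i, u i) * (∏ j, v j) * M.permanent := by
  simp only [permanent, of_apply, Finset.mul_sum, Finset.prod_mul_distrib]
  refine Finset.sum_congr rfl fun σ _ => ?_
  rw [Equiv.prod_comp σ u]
  ring

theorem permanent_updateRow_add (M : Matrix m m R) (i : m) (u v : m → R) :
    (M.updateRow i (u + v)).permanent =
      (M.updateRow i u).permanent + (M.updateRow i v).permanent := by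
  simp only [permanent, ← Finset.sum_add_distrib]
  refine Finset.sum_congr rfl fun σ _ => ?_
  have h (w : m → R) : ∏ j, M.updateRow i w (σ j) j =
      w (σ⁻¹ i) * ∏ j ∈ Finset.univ.erase (σ⁻¹ i), M (σ j) j := by
    rw [← Finset.mul_prod_erase _ _ (Finset.mem_univ (σ⁻¹ i))]
    congr 1
    · simp
    · refine Finset.prod_congr rfl fun j hj => ?_
      rw [updateRow_ne]
      rintro rfl
      simp at hj
  rw [h, h, h, Pi.add_apply, add_mul]

/-- If all rows but two are diagonal, the permanent is a `2 × 2` permanent times the product of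
the remaining diagonal entries. -/
theorem permanent_eq_of_two_rows (M : Matrix m m R) {a b : m} (hab : a ≠ b)
    (h : ∀ i, i ≠ a → i ≠ b → ∀ j, j ≠ i → M i j = 0) :
    M.permanent = (M a a * M b b + M b a * M a b) *
      ∏ i ∈ (Finset.univ.erase a).erase b, M i i := by
  have hne : (1 : Equiv.Perm m) ≠ Equiv.swap a b := by
    intro h1
    exact hab (by simpa using congrArg (fun σ : Equiv.Perm m => σ b) h1.symm)
  have hb : b ∈ Finset.univ.erase a := by simp [hab.symm]
  unfold permanent
  rw [Finset.sum_eq_add_of_mem 1 (Equiv.swap a b) (Finset.mem_univ _) (Finset.mem_univ _) hne,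
    ← Finset.mul_prod_erase _ _ (Finset.mem_univ a), ← Finset.mul_prod_erase _ _ hb,
    ← Finset.mul_prod_erase _ (fun i => M (Equiv.swap a b i) i) (Finset.mem_univ a),
    ← Finset.mul_prod_erase _ (fun i => M (Equiv.swap a b i) i) hb]
  · have : ∏ i ∈ (Finset.univ.erase a).erase b, M (Equiv.swap a b i) i =
        ∏ i ∈ (Finset.univ.erase a).erase b, M i i := by
      refine Finset.prod_congr rfl fun i hi => ?_
      simp only [Finset.mem_erase] at hi
      rw [Equiv.swap_apply_of_ne_of_ne hi.2.1 hi.1]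
    rw [this]
    simp
    ring
  · rintro σ - ⟨h1, h2⟩
    by_contra hσ
    have hne' (i : m) : M (σ i) i ≠ 0 := fun h0 =>
      hσ (Finset.prod_eq_zero (Finset.mem_univ i) h0)
    have hfix (i : m) (hia : i ≠ a) (hib : i ≠ b) : σ i = i := by
      have : M i (σ⁻¹ i) ≠ 0 := by simpa using hne' (σ⁻¹ i)
      by_contra hi
      exact this (h i hia hib _ fun h' => hi (Equiv.Perm.inv_eq_iff_eq.1 h').symm)
    have hcase (i : m) : σ i = i ∨ (i = a ∨ i = b) := by
      by_cases hia : i = a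
      · simp [hia]
      by_cases hib : i = b
      · simp [hib]
      exact Or.inl (hfix i hia hib)
    have hab' : σ a = a ∨ σ a = b := by
      by_contra! hc
      exact hc.1 (σ.injective (hfix _ hc.1 hc.2))
    have hba' : σ b = a ∨ σ b = b := by
      by_contra! hc
      exact hc.2 (σ.injective (hfix _ hc.1 hc.2))
    rcases hab' with ha | ha
    · have hb' : σ b = b := hba'.resolve_left fun h' => hab (σ.injective (ha.trans h'.symm))
      refine h1 (Equiv.ext fun i => ?_)
      rcases hcase i with hi | rfl | rfl
      · simpa using hi
      · simpa using ha
      · simpa using hb'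
    · have hb' : σ b = a := hba'.resolve_right fun h' => hab (σ.injective (ha.trans h'.symm))
      refine h2 (Equiv.ext fun i => ?_)
      by_cases hia : i = a
      · simp [hia, ha]
      by_cases hib : i = b
      · simp [hib, hb']
      rw [hfix i hia hib, Equiv.swap_apply_of_ne_of_ne hia hib]

/-- A matrix whose row `i` vanishes at all columns that come before column `i` in the order given
by an injective label `c` has the product of its diagonal entries as permanent. -/
theorem permanent_eq_prod_diag_of_injective (M : Matrix m m R) (c : m → ℕ)
    (hc : Function.Injective c) (h : ∀ i j, c j < c i → M i j = 0) :
    M.permanent = ∏ i, M i i := by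
  unfold permanent
  rw [Finset.sum_eq_single 1]
  · simp
  · intro σ _ hσ
    by_contra hne
    have hle (i : m) : c (σ i) ≤ c i := by
      by_contra! hlt
      exact hne (Finset.prod_eq_zero (Finset.mem_univ i) (h _ _ hlt))
    -- A nonzero term needs `c (σ i) ≤ c i` everywhere, and both sides have the same sum, so
    -- equality holds throughout.
    have hsum : ∑ i, c (σ i) = ∑ i, c i := Equiv.sum_comp σ c
    rw [Finset.sum_eq_sum_iff_of_le fun i _ => hle i] at hsum
    exact hσ (Equiv.ext fun i => by simpa using hc (hsum i (Finset.mem_univ i)))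
  · simp

end Permanent

end Matrix

/-! ### Permanental rank and arbitrary injective minors -/

section PermanentalRank

open Matrix

variable {F : Type*} [Field F] {n k : ℕ}

/-- Permanents ignore the order of rows and columns, so this frees later arguments from increasing
choices and from `Fin r` as index type. -/
theorem exists_orderEmbedding_comp_equiv {ι : Type*} [Fintype ι] [DecidableEq ι]
    {f : ι → Fin n} (hf : Function.Injective f) :
    ∃ (g : Fin (Fintype.card ι) ↪o Fin n) (e : ι ≃ Fin (Fintype.card ι)), f = g ∘ e := by
  have hs : (Finset.univ.image f).card = Fintype.card ι := by
    rw [Finset.card_image_of_injective _ hf, Finset.card_univ]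
  let o := (Finset.univ.image f).orderIsoOfFin hs
  let e₀ : ι → Fin (Fintype.card ι) := fun i => o.symm ⟨f i, by simp⟩
  have he₀ : Function.Injective e₀ := fun i j hij =>
    hf (congrArg Subtype.val (o.symm.injective hij))
  refine ⟨(Finset.univ.image f).orderEmbOfFin hs, Equiv.ofBijective e₀
    ((Fintype.bijective_iff_injective_and_card e₀).2 ⟨he₀, by simp⟩), ?_⟩
  funext i
  simp only [Function.comp, Equiv.ofBijective_apply]
  rw [← Finset.coe_orderIsoOfFin_apply]
  simp [e₀, o]

theorem permanent_submatrix_eq_zero {A : Matrix (Fin n) (Fin n) F} (hA : A ∈ permRankLE F n k)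
    {ι : Type*} [Fintype ι] [DecidableEq ι] (hι : k < Fintype.card ι) {f g : ι → Fin n}
    (hf : Function.Injective f) (hg : Function.Injective g) :
    (A.submatrix f g).permanent = 0 := by
  obtain ⟨f', e, rfl⟩ := exists_orderEmbedding_comp_equiv hf
  obtain ⟨g', e', rfl⟩ := exists_orderEmbedding_comp_equiv hg
  rw [← submatrix_submatrix, permanent_submatrix_equiv]
  by_contra h
  have h1 := (permanentalRank_isGreatest A).2 ⟨f', g', h⟩
  have h2 : permanentalRank A ≤ k := hA
  omega

theorem mem_permRankLE_of_forall {A : Matrix (Fin n) (Fin n) F}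
    (h : ∀ r, k < r → ∀ f g : Fin r → Fin n, Function.Injective f → Function.Injective g →
      (A.submatrix f g).permanent = 0) : A ∈ permRankLE F n k := by
  obtain ⟨f, g, hfg⟩ := (permanentalRank_isGreatest A).1
  by_contra hk
  exact hfg (h _ (not_le.1 hk) f g f.injective g.injective)

theorem transpose_mem_permRankLE {A : Matrix (Fin n) (Fin n) F} (hA : A ∈ permRankLE F n k) :
    Aᵀ ∈ permRankLE F n k :=
  mem_permRankLE_of_forall fun r hr f g hf hg => by
    rw [← transpose_submatrix, permanent_transpose]
    exact permanent_submatrix_eq_zero hA (by simpa using hr) hg hf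

end PermanentalRank

/-! ### Leading positions of a subspace -/

section LeadingPositions

open Matrix

variable {F : Type*} [Field F] {n k : ℕ}

/-- `(i, j)` is the position of the first nonzero entry, in the lexicographic order, of some matrix
in `W`. -/
def IsLeadingPosition (W : Submodule F (Matrix (Fin n) (Fin n) F)) (p : Fin n × Fin n) : Prop :=
  ∃ A ∈ W, A p.1 p.2 ≠ 0 ∧ (∀ i < p.1, ∀ j, A i j = 0) ∧ ∀ j < p.2, A p.1 j = 0

theorem eq_zero_of_forall_isLeadingPosition {W : Submodule F (Matrix (Fin n) (Fin n) F)}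
    {A : Matrix (Fin n) (Fin n) F} (hA : A ∈ W)
    (h : ∀ p, IsLeadingPosition W p → A p.1 p.2 = 0) : A = 0 := by
  classical
  by_contra hne
  have hrow : ∃ i, ∃ j, A i j ≠ 0 := by
    by_contra! h0
    exact hne (by ext i j; exact h0 i j)
  obtain ⟨i, hi, hmin⟩ := WellFounded.has_min (wellFounded_lt (α := Fin n)) {i | ∃ j, A i j ≠ 0} hrow
  obtain ⟨j, hj, hmin'⟩ := WellFounded.has_min (wellFounded_lt (α := Fin n)) {j | A i j ≠ 0} hi
  refine hj (h (i, j) ⟨A, hA, hj, fun i' hi' j' => ?_, fun j' hj' => ?_⟩)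
  · by_contra h0
    exact hmin i' ⟨j', h0⟩ hi'
  · by_contra h0
    exact hmin' j' h0 hj'

/-- A matching of size `r` among the leading positions of `W` yields a matrix in `W` with a nonzero
permanental minor of size `r`. -/
theorem exists_permanent_ne_zero_of_isLeadingPosition
    {W : Submodule F (Matrix (Fin n) (Fin n) F)} {r : ℕ} (f : Fin r ↪o Fin n) {g : Fin r → Fin n}
    (hg : Function.Injective g) (h : ∀ i, IsLeadingPosition W (f i, g i)) :
    ∃ A ∈ W, (A.submatrix f g).permanent ≠ 0 := by
  choose B hBW hB hrow hcol using h
  -- The first `t` rows come from one `A ∈ W`, and each remaining row `i` from its own witness `B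
  -- i`. Since `B l` vanishes above row `f l`, adding it to `A` changes only row `l = t` of `N (t +
  -- 1) A`. The permanent grows by that of `N t A`, which is nonzero, so `A` or `A + B l` works.
  let N (t : ℕ) (A : Matrix (Fin n) (Fin n) F) : Matrix (Fin r) (Fin r) F :=
    of fun i j => if (i : ℕ) < t then A (f i) (g j) else B i (f i) (g j)
  have key (t : ℕ) (ht : t ≤ r) : ∃ A ∈ W, (N t A).permanent ≠ 0 := by
    induction t with
    | zero =>
      refine ⟨0, W.zero_mem, ?_⟩
      rw [permanent_eq_prod_diag_of_injective _ (fun i => (g i : ℕ))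
        (fun i j hij => hg (Fin.ext hij))]
      · exact Finset.prod_ne_zero_iff.2 fun i _ => by simpa [N] using hB i
      · intro i j hij
        simpa [N] using hcol i (g j) hij
    | succ t ih =>
      obtain ⟨A, hA, hne⟩ := ih (by omega)
      let l : Fin r := ⟨t, by omega⟩
      have h1 : N (t + 1) (A + B l) = (N (t + 1) A).updateRow l
          ((fun j => A (f l) (g j)) + fun j => B l (f l) (g j)) := by
        ext i j
        by_cases hi : i = l
        · subst hi; simp [N, l]
        · have : (i : ℕ) ≠ t := fun h => hi (Fin.ext h)
          rw [updateRow_ne hi]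
          by_cases hit : (i : ℕ) < t
          · have := hrow l (f i) (f.strictMono hit) (g j)
            simp [N, Nat.lt_succ_of_lt hit, this]
          · simp [N, show ¬ (i : ℕ) < t + 1 by omega]
      have h2 : (N (t + 1) A).updateRow l (fun j => A (f l) (g j)) = N (t + 1) A := by
        ext i j
        by_cases hi : i = l
        · subst hi; simp [N, l]
        · rw [updateRow_ne hi]
      have h3 : (N (t + 1) A).updateRow l (fun j => B l (f l) (g j)) = N t A := by
        ext i j
        by_cases hi : i = l
        · subst hi; simp [N, l]
        · have : (i : ℕ) ≠ t := fun h => hi (Fin.ext h)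
          rw [updateRow_ne hi]
          by_cases hit : (i : ℕ) < t
          · simp [N, hit, Nat.lt_succ_of_lt hit]
          · simp [N, hit, show ¬ (i : ℕ) < t + 1 by omega]
      by_cases h0 : (N (t + 1) A).permanent = 0
      · refine ⟨A + B l, W.add_mem hA (hBW l), ?_⟩
        rwa [h1, permanent_updateRow_add, h2, h3, h0, zero_add]
      · exact ⟨A, hA, h0⟩
  obtain ⟨A, hA, hne⟩ := key r le_rfl
  refine ⟨A, hA, ?_⟩
  convert hne using 2
  ext i j
  simp [N]

end LeadingPositions

/-! ### Hall's theorem on the board -/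

section Matching

open Finset

variable {n k : ℕ}

/-- A set of at least `k * n` cells of an `n × n` board without `k + 1` cells in distinct rows and
distinct columns consists of `k` full rows or `k` full columns. -/
theorem eq_rows_or_eq_columns_of_no_matching (hkn : k < n) (P : Finset (Fin n × Fin n))
    (hP : k * n ≤ P.card)
    (h : ∀ (f : Fin (k + 1) ↪o Fin n) (g : Fin (k + 1) → Fin n), Function.Injective g →
      ∃ i, (f i, g i) ∉ P) :
    ∃ R : Finset (Fin n), R.card = k ∧ (P = R ×ˢ univ ∨ P = univ ×ˢ R) := by
  classical
  -- With `n - k - 1` dummy columns open to every row, a matching of all rows would use at least `k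
  -- + 1` genuine cells.
  let rel : Fin n → Fin n ⊕ Fin (n - k - 1) → Prop := fun i x =>
    Sum.elim (fun j => (i, j) ∈ P) (fun _ => True) x
  have hno : ¬ ∃ φ : Fin n → Fin n ⊕ Fin (n - k - 1),
      Function.Injective φ ∧ ∀ i, rel i (φ i) := by
    rintro ⟨φ, hφ, hrel⟩
    let Q : Finset (Fin n) := univ.filter fun i => (φ i).isLeft
    have hQc : (univ.filter fun i => ¬ (φ i).isLeft = true).card ≤ n - k - 1 := by
      have hle : (univ.filter fun i => ¬ (φ i).isLeft = true).card ≤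
          ((univ : Finset (Fin (n - k - 1))).image
            (Sum.inr : _ → Fin n ⊕ Fin (n - k - 1))).card := by
        refine card_le_card_of_injOn φ (fun i hi => ?_) hφ.injOn
        simp only [coe_filter, mem_univ, true_and, Set.mem_ofPred_eq] at hi
        rcases hx : φ i with x | x
        · simp [hx] at hi
        · simp
      exact hle.trans (card_image_le.trans (by simp))
    have hQ : k + 1 ≤ Q.card := by
      have := card_filter_add_card_filter_not (s := (univ : Finset (Fin n)))
        (fun i => (φ i).isLeft = true)
      rw [card_univ, Fintype.card_fin] at this
      simp only [Q]
      omega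
    obtain ⟨Q', hQ'Q, hQ'⟩ := exists_subset_card_eq hQ
    let f := Q'.orderEmbOfFin hQ'
    have hf (i : Fin (k + 1)) : ∃ j, φ (f i) = Sum.inl j := by
      have : (φ (f i)).isLeft = true := by
        have := hQ'Q (Q'.orderEmbOfFin_mem hQ' i)
        simpa [Q] using this
      exact Sum.isLeft_iff.1 this
    choose g hg using hf
    obtain ⟨i, hi⟩ := h f g fun i j hij => f.injective (hφ (by rw [hg, hg, hij]))
    have := hrel (f i)
    rw [hg] at this
    exact hi this
  rw [← Fintype.all_card_le_filter_rel_iff_exists_injective] at hno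
  push Not at hno
  obtain ⟨S, hS⟩ := hno
  let N : Finset (Fin n) := univ.filter fun j => ∃ i ∈ S, (i, j) ∈ P
  have hSne : S.Nonempty := by
    rw [nonempty_iff_ne_empty]
    rintro rfl
    simp at hS
  have hN : N.card + (n - k - 1) < S.card := by
    refine lt_of_le_of_lt ?_ hS
    obtain ⟨s, hs⟩ := hSne
    have : N.disjSum (univ : Finset (Fin (n - k - 1))) ⊆
        univ.filter fun b => ∃ a ∈ S, rel a b := by
      intro x hx
      rcases x with x | x
      · simpa [N, rel] using hx
      · simpa [rel] using ⟨s, hs⟩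
    have hle := card_le_card this
    rw [card_disjSum, card_univ, Fintype.card_fin] at hle
    exact hle.trans (le_of_eq (by congr!))
  have hSc : Sᶜ.card + S.card = n := by simp
  have hPsub : P ⊆ (Sᶜ ×ˢ univ) ∪ (S ×ˢ N) := by
    rintro ⟨i, j⟩ hij
    by_cases hi : i ∈ S
    · have : j ∈ N := by simpa [N] using ⟨i, hi, hij⟩
      simp [hi, this]
    · simp [hi]
  have hcard : P.card ≤ Sᶜ.card * n + S.card * N.card :=
    (card_le_card hPsub).trans ((card_union_le _ _).trans (by simp [card_product]))
  have hSn : S.card ≤ n := by omega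
  -- The Hall violator gives $|S^c| + |N| \le k$, while $kn \le |S^c| n + |S||N|$. This forces
  -- equality, and then $|S^c||N| = 0$: only rows or only columns are used.
  have hsum : Sᶜ.card + N.card = k := by
    by_contra hne
    have hlt : Sᶜ.card + N.card + 1 ≤ k := by omega
    have h1 : (Sᶜ.card + N.card + 1) * n ≤ k * n := Nat.mul_le_mul_right _ hlt
    have h2 : S.card * N.card ≤ n * N.card := Nat.mul_le_mul_right _ hSn
    nlinarith
  have hprod : Sᶜ.card * N.card = 0 := by
    have h1 : S.card * N.card + Sᶜ.card * N.card = n * N.card := by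
      rw [← add_mul, add_comm, hSc]
    have h2 : Sᶜ.card * n + n * N.card = k * n := by rw [← hsum]; ring
    omega
  rcases Nat.mul_eq_zero.1 hprod with h0 | h0
  · refine ⟨N, by omega, Or.inr ?_⟩
    have hSu : S = univ := by
      rw [card_eq_zero] at h0
      simpa using h0
    refine eq_of_subset_of_card_le (fun p hp => ?_) ?_
    · have := hPsub hp
      simpa [hSu] using this
    · rw [card_product, card_univ, Fintype.card_fin, show N.card = k by omega, mul_comm]
      exact hP
  · refine ⟨Sᶜ, by omega, Or.inl ?_⟩
    have hNe : N = ∅ := card_eq_zero.1 h0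
    refine eq_of_subset_of_card_le (fun p hp => ?_) ?_
    · have := hPsub hp
      simpa [hNe] using this
    · rw [card_product, card_univ, Fintype.card_fin, show Sᶜ.card = k by omega]
      exact hP

end Matching

/-! ### Maximal subspaces are coordinate subspaces -/

section CoordinateSubspaces

open Matrix

variable {F : Type*} [Field F] {n k : ℕ}

theorem exists_injective_apply_eq_and_forall_ne {α : Type*} [Fintype α]
    (hα : Fintype.card α < n) (a : α) {m j : Fin n} (hmj : m ≠ j) :
    ∃ π : α → Fin n, Function.Injective π ∧ π a = m ∧ ∀ x, π x ≠ j := by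
  classical
  obtain ⟨π⟩ : Nonempty (α ↪ {x : Fin n // x ≠ j}) :=
    Function.Embedding.nonempty_of_card_le (by
      rw [Fintype.card_subtype_compl, Fintype.card_subtype_eq, Fintype.card_fin]; omega)
  refine ⟨fun x => Equiv.swap (π a : Fin n) m (π x),
    (Equiv.injective _).comp (Subtype.val_injective.comp π.injective), by simp, fun x hx => ?_⟩
  rw [Equiv.swap_apply_eq_iff, Equiv.swap_apply_of_ne_of_ne (π a).2.symm hmj.symm] at hx
  exact (π x).2 hx

/-- A linear lift of matrices with rows indexed by a `k`-element set `R` to `n × n` matrices of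
permanental rank at most `k` with the given rows on `R` vanishes on all other rows. -/
theorem lift_apply_eq_zero (h2 : (2 : F) ≠ 0) (hn : 3 ≤ n) (hkn : k < n)
    {R : Finset (Fin n)} (hR : R.card = k)
    (ψ : Matrix R (Fin n) F →ₗ[F] Matrix (Fin n) (Fin n) F)
    (hψ : ∀ X, ψ X ∈ permRankLE F n k) (hψR : ∀ X (i : R) j, ψ X i j = X i j)
    (X : Matrix R (Fin n) F) {l : Fin n} (hl : l ∉ R) (j : Fin n) : ψ X l j = 0 := by
  classical
  have key (i : R) (m j : Fin n) (hmj : m ≠ j) :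
      ψ (single i m 1) l j = 0 ∧ ψ (single i j 1) l j + ψ (single i m 1) l m = 0 := by
    obtain ⟨π, hπ, hπi, hπj⟩ := exists_injective_apply_eq_and_forall_ne
      (α := R) (by simpa [hR] using hkn) i hmj
    -- The units of `Z` avoid columns `j` and `m`, so the minor on rows `R ∪ {l}` collapses to a `2
    -- × 2` permanent on rows `l`, `i` and columns `j`, `m`.
    let Z : Matrix R (Fin n) F := of fun a b => if a ≠ i ∧ b = π a then 1 else 0
    have hper (c t : F) :
        (c * ψ (single i m 1) l j + t * ψ (single i j 1) l j + ψ Z l j) * c +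
          t * (c * ψ (single i m 1) l m + t * ψ (single i j 1) l m + ψ Z l m) = 0 := by
      let Y : Matrix R (Fin n) F := c • single i m 1 + t • single i j 1 + Z
      have hY (q : Fin n) : ψ Y l q =
          c * ψ (single i m 1) l q + t * ψ (single i j 1) l q + ψ Z l q := by
        simp only [Y, map_add, map_smul, Matrix.add_apply, Matrix.smul_apply, smul_eq_mul]
      let f : Option R → Fin n := fun x => x.elim l Subtype.val
      let g : Option R → Fin n := fun x => x.elim j π
      have hf : Function.Injective f := by
        rintro (_ | a) (_ | b) hab
        · rfl
        · exact absurd (show l ∈ R by simpa [f] using (show l = b from hab) ▸ b.2) hl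
        · exact absurd (show l ∈ R by simpa [f] using (show (a : Fin n) = l from hab) ▸ a.2) hl
        · exact congrArg some (Subtype.ext hab)
      have hg : Function.Injective g := by
        rintro (_ | a) (_ | b) hab
        · rfl
        · exact absurd hab.symm (hπj b)
        · exact absurd hab (hπj a)
        · exact congrArg some (hπ hab)
      have h0 := permanent_submatrix_eq_zero (hψ Y) (by simp [hR]) hf hg
      have hYi (q : Fin n) : Y i q = c * (if m = q then 1 else 0) + t * if j = q then 1 else 0 := by
        simp [Y, Z, single_apply]
      have hYa (a : R) (ha : a ≠ i) (q : Fin n) : Y a q = if q = π a then 1 else 0 := by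
        simp [Y, Z, ha, ha.symm]
      rw [permanent_eq_of_two_rows _ (a := none) (b := some i) (by simp)] at h0
      · have hprod : ∏ x ∈ (Finset.univ.erase none).erase (some i),
            (ψ Y).submatrix f g x x = 1 := by
          refine Finset.prod_eq_one fun x hx => ?_
          rcases x with _ | a
          · simp at hx
          · have ha : a ≠ i := by simpa using hx
            simp [f, g, hψR, hYa a ha]
        rw [hprod, mul_one] at h0
        simp only [submatrix_apply, f, g, Option.elim, hψR, hYi, hπi, hY] at h0
        simpa [hmj, hmj.symm] using h0
      · rintro (_ | a) h1 h2 q hq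
        · exact absurd rfl h1
        · have ha : a ≠ i := by simpa using h2
          simp only [submatrix_apply, f, Option.elim, hψR, hYa a ha]
          rw [if_neg]
          rcases q with _ | b
          · exact fun h => hπj a h.symm
          · exact fun h => hq (congrArg some (hπ h))
    generalize ψ (single i m 1) l j = u at *
    generalize ψ (single i j 1) l j = v at *
    generalize ψ Z l j = w at *
    generalize ψ (single i m 1) l m = u' at *
    generalize ψ (single i j 1) l m = v' at *
    generalize ψ Z l m = w' at *
    -- `hper` is a polynomial of degree at most two in `c`, `t` without constant term. The values
    -- `±1` isolate its square terms because `2 ≠ 0`, and `(1, 1)` then yields the mixed one.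
    have e1 := hper 1 0
    have e2 := hper (-1) 0
    have e3 := hper 0 1
    have e4 := hper 0 (-1)
    have e5 := hper 1 1
    have hu : u = 0 := by
      have : 2 * u = 0 := by linear_combination e1 + e2
      simpa [h2] using this
    have hv : v' = 0 := by
      have : 2 * v' = 0 := by linear_combination e3 + e4
      simpa [h2] using this
    exact ⟨hu, by linear_combination e5 - e1 - e3⟩
  have hall (i : R) (m j : Fin n) : ψ (single i m 1) l j = 0 := by
    by_cases hmj : m = j
    · subst hmj
      -- Three distinct columns are needed: three quantities whose pairwise sums vanish are all zero
      -- when `2 ≠ 0`.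
      obtain ⟨p, hp⟩ : ∃ p, p ∉ ({m} : Finset (Fin n)) := by
        by_contra! hc
        have := Finset.card_le_card (fun x _ => hc x : Finset.univ ⊆ ({m} : Finset (Fin n)))
        simp at this
        omega
      obtain ⟨q, hq⟩ : ∃ q, q ∉ ({m, p} : Finset (Fin n)) := by
        by_contra! hc
        have := Finset.card_le_card (fun x _ => hc x : Finset.univ ⊆ ({m, p} : Finset (Fin n)))
        have := this.trans Finset.card_le_two
        simp at this
        omega
      simp only [Finset.mem_singleton, Finset.mem_insert, not_or] at hp hq
      have e1 := (key i p m hp).2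
      have e2 := (key i q m hq.1).2
      have e3 := (key i q p hq.2).2
      have : 2 * ψ (single i m 1) l m = 0 := by linear_combination e1 + e2 - e3
      simpa [h2] using this
    · exact (key i m j hmj).1
  rw [matrix_eq_sum_single X]
  simp only [map_sum, Matrix.sum_apply]
  refine Finset.sum_eq_zero fun i _ => Finset.sum_eq_zero fun m _ => ?_
  have : single i m (X i m) = X i m • single i m (1 : F) := by simp
  rw [this, map_smul, Matrix.smul_apply, hall, smul_zero]

/-- The matrices supported on a set of positions. -/
def supportedMatrices (F : Type*) [Field F] {n : ℕ} (S : Finset (Fin n × Fin n)) :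
    Submodule F (Matrix (Fin n) (Fin n) F) where
  carrier := {A | ∀ i j, (i, j) ∉ S → A i j = 0}
  add_mem' hA hB i j hij := by simp [hA i j hij, hB i j hij]
  zero_mem' i j _ := rfl
  smul_mem' c A hA i j hij := by simp [hA i j hij]

theorem single_mem_supportedMatrices {S : Finset (Fin n × Fin n)} {i j : Fin n}
    (h : (i, j) ∈ S) (c : F) : single i j c ∈ supportedMatrices F S := by
  intro a b hab
  rw [single_apply_of_ne]
  rintro ⟨rfl, rfl⟩
  exact hab h

/-- Restriction of the matrices in `W` to the positions in `S`. -/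
def restrictPositions (W : Submodule F (Matrix (Fin n) (Fin n) F)) (S : Finset (Fin n × Fin n)) :
    W →ₗ[F] (S → F) where
  toFun A p := (A : Matrix (Fin n) (Fin n) F) p.1.1 p.1.2
  map_add' _ _ := rfl
  map_smul' _ _ := rfl

theorem finrank_supportedMatrices (S : Finset (Fin n × Fin n)) :
    Module.finrank F (supportedMatrices F S) = S.card := by
  classical
  have hb : Function.Bijective (restrictPositions (supportedMatrices F S) S) := by
    constructor
    · rw [← LinearMap.ker_eq_bot, LinearMap.ker_eq_bot']
      intro A hA
      ext i j
      by_cases hij : (i, j) ∈ S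
      · exact congrFun hA ⟨(i, j), hij⟩
      · exact A.2 i j hij
    · intro X
      refine ⟨⟨of fun i j => if h : (i, j) ∈ S then X ⟨(i, j), h⟩ else 0, fun i j hij => ?_⟩, ?_⟩
      · simp [hij]
      · ext ⟨⟨i, j⟩, hp⟩
        exact dif_pos hp
  rw [(LinearEquiv.ofBijective _ hb).finrank_eq]
  simp

/-- A subspace of dimension `k * n` of matrices of permanental rank at most `k` consists of all
matrices supported on `k` given rows, or on `k` given columns. -/
theorem eq_supportedMatrices_of_finrank_eq (h2 : (2 : F) ≠ 0) (hn : 3 ≤ n) (hkn : k < n)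
    {W : Submodule F (Matrix (Fin n) (Fin n) F)} (hW : ∀ A ∈ W, A ∈ permRankLE F n k)
    (hdim : Module.finrank F W = k * n) :
    ∃ S : Finset (Fin n × Fin n), W = supportedMatrices F S := by
  classical
  let P : Finset (Fin n × Fin n) := Finset.univ.filter (IsLeadingPosition W)
  have hinj : Function.Injective (restrictPositions W P) := by
    rw [← LinearMap.ker_eq_bot, LinearMap.ker_eq_bot']
    intro A hA
    refine Subtype.ext (eq_zero_of_forall_isLeadingPosition A.2 fun p hp => ?_)
    exact congrFun hA ⟨p, by simpa [P] using hp⟩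
  have hcard : k * n ≤ P.card := by
    have := LinearMap.finrank_le_finrank_of_injective hinj
    simpa [hdim] using this
  obtain ⟨R, hR, hPR⟩ := eq_rows_or_eq_columns_of_no_matching hkn P hcard fun f g hg => by
    by_contra! hc
    obtain ⟨A, hA, hne⟩ := exists_permanent_ne_zero_of_isLeadingPosition f hg
      (fun i => by simpa [P] using hc i)
    exact hne (permanent_submatrix_eq_zero (hW A hA) (by simp) f.injective hg)
  have hPcard : P.card = k * n := by
    rcases hPR with h | h
    · rw [h, Finset.card_product, hR]; simp
    · rw [h, Finset.card_product, hR]; simp [mul_comm]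
  have hbij : Function.Bijective (restrictPositions W P) :=
    ⟨hinj, (LinearMap.injective_iff_surjective_of_finrank_eq_finrank
      (by simp [hdim, hPcard])).1 hinj⟩
  -- The inverse of `e` rebuilds a matrix of `W` from its entries on `P`; this is the lift to which
  -- `lift_apply_eq_zero` applies.
  let e := LinearEquiv.ofBijective _ hbij
  have he (A : W) (X : P → F) (hX : ∀ p : P, (A : Matrix (Fin n) (Fin n) F) p.1.1 p.1.2 = X p) :
      e.symm X = A := by
    rw [LinearEquiv.symm_apply_eq]
    exact funext fun p => (hX p).symm
  have he' (X : P → F) (p : P) : (e.symm X : Matrix (Fin n) (Fin n) F) p.1.1 p.1.2 = X p :=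
    congrFun (e.apply_symm_apply X) p
  refine ⟨P, Submodule.eq_of_le_of_finrank_eq (fun A hA i j hij => ?_)
    (by rw [hdim, finrank_supportedMatrices, hPcard])⟩
  rcases hPR with h | h
  · have hmem (p : P) : p.1.1 ∈ R := by simpa [h] using p.2
    let ψ : Matrix R (Fin n) F →ₗ[F] Matrix (Fin n) (Fin n) F :=
      { toFun := fun X => (e.symm fun p => X ⟨p.1.1, hmem p⟩ p.1.2 : W)
        map_add' := fun X Y => by
          rw [← Submodule.coe_add, ← map_add]; rfl
        map_smul' := fun c X => by
          rw [RingHom.id_apply, ← Submodule.coe_smul, ← map_smul]; rfl }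
    have := lift_apply_eq_zero h2 hn hkn hR ψ (fun X => hW _ (Subtype.prop _))
      (fun X i j => he' _ ⟨(i, j), by simp [h]⟩) (of fun i j => A i j) (l := i)
      (by simpa [h] using hij) j
    rw [← this]
    exact congrFun (congrFun (congrArg Subtype.val (he ⟨A, hA⟩ _ fun p => rfl)) i) j |>.symm
  · have hmem (p : P) : p.1.2 ∈ R := by simpa [h] using p.2
    let ψ : Matrix R (Fin n) F →ₗ[F] Matrix (Fin n) (Fin n) F :=
      { toFun := fun X => (e.symm fun p => X ⟨p.1.2, hmem p⟩ p.1.1 : W).1ᵀ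
        map_add' := fun X Y => by
          rw [← transpose_add, ← Submodule.coe_add, ← map_add]; rfl
        map_smul' := fun c X => by
          rw [RingHom.id_apply, ← transpose_smul, ← Submodule.coe_smul, ← map_smul]; rfl }
    have := lift_apply_eq_zero h2 hn hkn hR ψ
      (fun X => transpose_mem_permRankLE (hW _ (Subtype.prop _)))
      (fun X i j => he' _ ⟨(j, i), by simp [h]⟩) (of fun i j => A j i) (l := j)
      (by simpa [h] using hij) i
    rw [← this]
    exact congrFun (congrFun (congrArg Subtype.val (he ⟨A, hA⟩ _ fun p => rfl)) i) j |>.symm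

end CoordinateSubspaces

/-! ### Collinearity-preserving maps of the board -/

section Grid

variable {n : ℕ}

/-- Two points differing in the first coordinate share the second; a point off that line would share
its first coordinate with both. -/
theorem fst_const_or_snd_const {ι α β : Type*} (f : ι → α × β)
    (h : ∀ i j, (f i).1 = (f j).1 ∨ (f i).2 = (f j).2) :
    (∀ i j, (f i).1 = (f j).1) ∨ ∀ i j, (f i).2 = (f j).2 := by
  by_contra! hc
  obtain ⟨⟨i, j, hij⟩, ⟨x, y, hxy⟩⟩ := hc
  have hij' := (h i j).resolve_left hij
  have key (z : ι) : (f z).2 = (f i).2 := by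
    by_contra hz
    have h1 := (h z i).resolve_right hz
    have h2 := (h z j).resolve_right (hij' ▸ hz)
    exact hij (h1.symm.trans h2)
  exact hxy ((key x).trans (key y).symm)

/-- By counting, an injection sends a line onto a whole line. A row sent to a column would meet the
image of row `i₀`, and a column sent to a row would overlap the image of a row in too many cells,
both against injectivity. -/
theorem eq_prodMap_of_collinear_of_fst_const (hn : 2 ≤ n) {φ : Fin n × Fin n → Fin n × Fin n}
    (hφ : Function.Injective φ)
    (h : ∀ p q, p.1 = q.1 ∨ p.2 = q.2 → (φ p).1 = (φ q).1 ∨ (φ p).2 = (φ q).2)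
    {i₀ : Fin n} (hi₀ : ∀ j j', (φ (i₀, j)).1 = (φ (i₀, j')).1) :
    ∃ σ τ : Fin n → Fin n, ∀ i j, φ (i, j) = (σ i, τ j) := by
  have surj {i : Fin n} (hi : ∀ j j', (φ (i, j)).1 = (φ (i, j')).1) (y : Fin n) :
      ∃ j, (φ (i, j)).2 = y :=
    Finite.surjective_of_injective (f := fun j => (φ (i, j)).2)
      (fun j j' hjj => (Prod.ext_iff.1 (hφ (Prod.ext (hi j j') hjj))).2) y
  have surj' {i : Fin n} (hi : ∀ j j', (φ (i, j)).2 = (φ (i, j')).2) (y : Fin n) :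
      ∃ j, (φ (i, j)).1 = y :=
    Finite.surjective_of_injective (f := fun j => (φ (i, j)).1)
      (fun j j' hjj => (Prod.ext_iff.1 (hφ (Prod.ext hjj (hi j j')))).2) y
  have hrow (i j j' : Fin n) : (φ (i, j)).1 = (φ (i, j')).1 := by
    rcases fst_const_or_snd_const (fun j => φ (i, j)) (fun j j' => h _ _ (Or.inl rfl)) with hi | hi
    · exact hi j j'
    · obtain ⟨a, ha⟩ := surj hi₀ (φ (i, j)).2
      obtain ⟨b, hb⟩ := surj' hi (φ (i₀, a)).1
      have : φ (i₀, a) = φ (i, b) := Prod.ext hb.symm (ha.trans (hi j b))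
      have := (Prod.ext_iff.1 (hφ this)).1
      simp only at this
      subst this
      exact hi₀ j j'
  have hcol (j i i' : Fin n) : (φ (i, j)).2 = (φ (i', j)).2 := by
    rcases fst_const_or_snd_const (fun i => φ (i, j)) (fun i i' => h _ _ (Or.inr rfl)) with hj | hj
    · obtain ⟨a, ha⟩ := surj (hrow i) (φ (i', j)).2
      have : φ (i, a) = φ (i', j) := Prod.ext ((hrow i a j).trans (hj i i')) ha
      have := (Prod.ext_iff.1 (hφ this)).1
      simp only at this
      rw [this]
    · exact hj i i'
  have : NeZero n := ⟨by omega⟩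
  exact ⟨fun i => (φ (i, 0)).1, fun j => (φ (0, j)).2,
    fun i j => Prod.ext (hrow i j 0) (hcol j i 0)⟩

/-- An injective self-map of the cells of a square board that maps cells on a common line to cells
on a common line permutes rows and columns, up to transposition. -/
theorem eq_prodMap_or_eq_swap_of_collinear (hn : 2 ≤ n) {φ : Fin n × Fin n → Fin n × Fin n}
    (hφ : Function.Injective φ)
    (h : ∀ p q, p.1 = q.1 ∨ p.2 = q.2 → (φ p).1 = (φ q).1 ∨ (φ p).2 = (φ q).2) :
    ∃ σ τ : Equiv.Perm (Fin n),
      (∀ i j, φ (i, j) = (σ i, τ j)) ∨ ∀ i j, φ (i, j) = (σ j, τ i) := by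
  have : NeZero n := ⟨by omega⟩
  rcases fst_const_or_snd_const (fun j => φ (0, j)) (fun j j' => h _ _ (Or.inl rfl)) with h0 | h0
  · obtain ⟨σ, τ, hστ⟩ := eq_prodMap_of_collinear_of_fst_const hn hφ h h0
    refine ⟨Equiv.ofBijective σ (Finite.injective_iff_bijective.1 fun i i' hi => ?_),
      Equiv.ofBijective τ (Finite.injective_iff_bijective.1 fun j j' hj => ?_),
      Or.inl hστ⟩
    · exact (Prod.ext_iff.1 (hφ (a₁ := (i, 0)) (a₂ := (i', 0)) (by rw [hστ, hστ, hi]))).1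
    · exact (Prod.ext_iff.1 (hφ (a₁ := (0, j)) (a₂ := (0, j')) (by rw [hστ, hστ, hj]))).2
  · obtain ⟨τ, σ, hστ⟩ := eq_prodMap_of_collinear_of_fst_const hn
      (φ := Prod.swap ∘ φ) (Prod.swap_injective.comp hφ) (fun p q hpq => (h p q hpq).symm) h0
    have hστ' (i j : Fin n) : φ (i, j) = (σ j, τ i) := by
      rw [← Prod.swap_swap (φ (i, j)), show (φ (i, j)).swap = (τ i, σ j) from hστ i j]; rfl
    refine ⟨Equiv.ofBijective σ (Finite.injective_iff_bijective.1 fun j j' hj => ?_),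
      Equiv.ofBijective τ (Finite.injective_iff_bijective.1 fun i i' hi => ?_),
      Or.inr hστ'⟩
    · exact (Prod.ext_iff.1 (hφ (a₁ := (0, j)) (a₂ := (0, j')) (by rw [hστ', hστ', hj]))).2
    · exact (Prod.ext_iff.1 (hφ (a₁ := (i, 0)) (a₂ := (i', 0)) (by rw [hστ', hστ', hi]))).1

end Grid

/-! ### Linear preservers -/

section Preservers

open Matrix

variable {F : Type*} [Field F] {n k : ℕ}

/-- A nonzero permanent has a nonzero term. This bounds the permanental rank by looking at the
support alone. -/
theorem exists_matching_of_notMem_permRankLE {A : Matrix (Fin n) (Fin n) F}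
    (hA : A ∉ permRankLE F n k) :
    ∃ r, k < r ∧ ∃ f g : Fin r → Fin n, Function.Injective f ∧ Function.Injective g ∧
      ∀ i, A (f i) (g i) ≠ 0 := by
  by_contra! hc
  refine hA (mem_permRankLE_of_forall fun r hr f g hf hg => ?_)
  refine Finset.sum_eq_zero fun σ _ => ?_
  obtain ⟨i, hi⟩ := hc r hr (f ∘ σ) g (hf.comp σ.injective) hg
  exact Finset.prod_eq_zero (Finset.mem_univ i) hi

theorem mem_permRankLE_of_mem_rows {R : Finset (Fin n)} (hR : R.card ≤ k)
    {A : Matrix (Fin n) (Fin n) F} (hA : A ∈ supportedMatrices F (R ×ˢ Finset.univ)) :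
    A ∈ permRankLE F n k := by
  by_contra hc
  obtain ⟨r, hr, f, g, hf, -, h⟩ := exists_matching_of_notMem_permRankLE hc
  have : (Finset.univ : Finset (Fin r)).card ≤ R.card :=
    Finset.card_le_card_of_injOn f (fun i _ => by
      by_contra hi
      exact h i (hA _ _ (by simpa using hi))) hf.injOn
  rw [Finset.card_univ, Fintype.card_fin] at this
  omega

theorem mem_permRankLE_of_mem_columns {R : Finset (Fin n)} (hR : R.card ≤ k)
    {A : Matrix (Fin n) (Fin n) F} (hA : A ∈ supportedMatrices F (Finset.univ ×ˢ R)) :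
    A ∈ permRankLE F n k := by
  rw [← transpose_transpose A]
  refine transpose_mem_permRankLE (mem_permRankLE_of_mem_rows hR fun i j hij => hA j i ?_)
  simpa using hij

/-- `k + 1` positions, two of which lie on a common line, carry only matrices of permanental rank
at most `k`. -/
theorem mem_permRankLE_of_collinear {Q : Finset (Fin n × Fin n)} (hQ : Q.card ≤ k + 1)
    {p q : Fin n × Fin n} (hp : p ∈ Q) (hq : q ∈ Q) (hpq : p ≠ q)
    (hcol : p.1 = q.1 ∨ p.2 = q.2) {A : Matrix (Fin n) (Fin n) F}
    (hA : A ∈ supportedMatrices F Q) : A ∈ permRankLE F n k := by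
  by_contra hc
  obtain ⟨r, hr, f, g, hf, hg, h⟩ := exists_matching_of_notMem_permRankLE hc
  have hmem (i : Fin r) : (f i, g i) ∈ Q := by
    by_contra hi
    exact h i (hA _ _ hi)
  have hinj : Function.Injective fun i => (f i, g i) := fun i j hij =>
    hf (Prod.ext_iff.1 hij).1
  have himage : Finset.univ.image (fun i => (f i, g i)) = Q := by
    refine Finset.eq_of_subset_of_card_le (fun x hx => ?_) ?_
    · obtain ⟨i, -, rfl⟩ := Finset.mem_image.1 hx
      exact hmem i
    · rw [Finset.card_image_of_injective _ hinj, Finset.card_univ, Fintype.card_fin]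
      omega
  rw [← himage] at hp hq
  obtain ⟨i, -, rfl⟩ := Finset.mem_image.1 hp
  obtain ⟨j, -, rfl⟩ := Finset.mem_image.1 hq
  have hij : i = j := hcol.elim (fun h => hf h) fun h => hg h
  exact hpq (by rw [hij])

theorem exists_injective_zero_last (hk : 1 ≤ k) (hkn : k < n) {a b : Fin n} (hab : a ≠ b) :
    ∃ f : Fin (k + 1) → Fin n, Function.Injective f ∧ f 0 = a ∧ f (Fin.last k) = b := by
  let e : Fin (k + 1) → Fin n := Fin.castLE (by omega)
  have he : Function.Injective e := Fin.castLE_injective _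
  have h0 : e (Fin.last k) ≠ e 0 := fun h => by
    have := congrArg Fin.val (he h)
    simp at this
    omega
  refine ⟨fun x => Equiv.swap (Equiv.swap (e 0) a (e (Fin.last k))) b (Equiv.swap (e 0) a (e x)),
    (Equiv.injective _).comp ((Equiv.injective _).comp he), ?_, by simp⟩
  simp only [Equiv.swap_apply_left]
  refine Equiv.swap_apply_of_ne_of_ne (fun h => h0 ?_) hab
  rw [eq_comm, Equiv.swap_apply_eq_iff, Equiv.swap_apply_right] at h
  exact h

/-- Extend `B` by zeros: a minor larger than `k` either contains a zero line or is a rearrangement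
of `B`. -/
theorem exists_mem_permRankLE_submatrix_eq {f g : Fin (k + 1) → Fin n}
    (hf : Function.Injective f) (hg : Function.Injective g)
    {B : Matrix (Fin (k + 1)) (Fin (k + 1)) F} (hB : B.permanent = 0) :
    ∃ A ∈ permRankLE F n k, A.submatrix f g = B := by
  classical
  let A : Matrix (Fin n) (Fin n) F := of fun a b =>
    if a ∈ Set.range f ∧ b ∈ Set.range g then B (Function.invFun f a) (Function.invFun g b) else 0
  have hAB : A.submatrix f g = B := by
    ext x y
    simp [A, Function.leftInverse_invFun hf x, Function.leftInverse_invFun hg y]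
  refine ⟨A, mem_permRankLE_of_forall fun r hr f' g' hf' hg' => ?_, hAB⟩
  by_cases hr' : ∀ x, f' x ∈ Set.range f
  · by_cases hc' : ∀ x, g' x ∈ Set.range g
    · choose u hu using hr'
      choose v hv using hc'
      have hu' : Function.Injective u := fun x y hxy => hf' (by rw [← hu, ← hu, hxy])
      have hv' : Function.Injective v := fun x y hxy => hg' (by rw [← hv, ← hv, hxy])
      have hcard := Fintype.card_le_of_injective u hu'
      rw [Fintype.card_fin, Fintype.card_fin] at hcard
      have hcard' : Fintype.card (Fin r) = Fintype.card (Fin (k + 1)) := by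
        rw [Fintype.card_fin, Fintype.card_fin]; omega
      have := permanent_submatrix_equiv (A.submatrix f g)
        (Equiv.ofBijective u ((Fintype.bijective_iff_injective_and_card u).2 ⟨hu', hcard'⟩))
        (Equiv.ofBijective v ((Fintype.bijective_iff_injective_and_card v).2 ⟨hv', hcard'⟩))
      rw [hAB, hB, ← hAB] at this
      rw [← this]
      congr 1
      ext x y
      simp [hu, hv]
    · push Not at hc'
      obtain ⟨y, hy⟩ := hc'
      exact permanent_eq_zero_of_col_eq_zero _ y fun x => if_neg fun h => hy h.2
  · push Not at hr'
    obtain ⟨x, hx⟩ := hr'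
    exact permanent_eq_zero_of_row_eq_zero _ x fun y => if_neg fun h => hx h.1

/-- A bijective linear map preserving permanental rank at most `k` is monomial in the standard
basis. -/
theorem exists_monomial_of_preserves (h2 : (2 : F) ≠ 0) (hn : 3 ≤ n) (hk : 1 ≤ k) (hkn : k < n)
    {T : Matrix (Fin n) (Fin n) F →ₗ[F] Matrix (Fin n) (Fin n) F} (hT : Function.Bijective T)
    (hΛ : ∀ A ∈ permRankLE F n k, T A ∈ permRankLE F n k) :
    ∃ (φ : Fin n × Fin n → Fin n × Fin n) (c : Fin n → Fin n → F),
      Function.Injective φ ∧ (∀ i j, c i j ≠ 0) ∧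
        ∀ A i j, T A (φ (i, j)).1 (φ (i, j)).2 = c i j * A i j := by
  classical
  have hmap (S : Finset (Fin n × Fin n)) (hcard : S.card = k * n)
      (hS : ∀ A ∈ supportedMatrices F S, A ∈ permRankLE F n k) :
      ∃ S', (supportedMatrices F S).map T = supportedMatrices F S' := by
    refine eq_supportedMatrices_of_finrank_eq h2 hn hkn (k := k) ?_ ?_
    · rintro _ ⟨A, hA, rfl⟩
      exact hΛ A (hS A hA)
    · rw [← hcard, ← finrank_supportedMatrices (F := F)]
      exact (LinearEquiv.ofBijective T hT).finrank_map_eq (supportedMatrices F S)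
  have hexists (i j : Fin n) : ∃ (p : Fin n × Fin n) (c : F), c ≠ 0 ∧
      T (single i j 1) = single p.1 p.2 c := by
    have hne : T (single i j 1) ≠ 0 := by
      rw [Ne, map_eq_zero_iff T hT.1]
      intro h
      simpa using congrFun (congrFun h i) j
    obtain ⟨p, q, hpq⟩ : ∃ p q, T (single i j 1) p q ≠ 0 := by
      by_contra! h
      exact hne (by ext p q; exact h p q)
    obtain ⟨X, hX⟩ := hT.2 (single p q 1)
    -- The image of such a coordinate space is again one, and it has `(p, q)` in its support; hence
    -- it contains the unit at `(p, q)`, and the space itself contains `X`.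
    have hXS (S : Finset (Fin n × Fin n)) (hcard : S.card = k * n)
        (hS : ∀ A ∈ supportedMatrices F S, A ∈ permRankLE F n k) (hij : (i, j) ∈ S) :
        X ∈ supportedMatrices F S := by
      obtain ⟨S', hS'⟩ := hmap S hcard hS
      have h1 : T (single i j 1) ∈ supportedMatrices F S' := by
        rw [← hS']
        exact Submodule.mem_map_of_mem (single_mem_supportedMatrices hij 1)
      have h2 : (p, q) ∈ S' := by
        by_contra h
        exact hpq (h1 p q h)
      have h3 : single p q 1 ∈ (supportedMatrices F S).map T := by
        rw [hS']
        exact single_mem_supportedMatrices h2 1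
      obtain ⟨Y, hY, hYX⟩ := h3
      rwa [hT.1 (hX.trans hYX.symm)]
    have hset (a b : Fin n) (hab : a ≠ b) :
        ∃ R : Finset (Fin n), R.card = k ∧ a ∈ R ∧ b ∉ R := by
      obtain ⟨R, h1, h2, h3⟩ := Finset.exists_subsuperset_card_eq (n := k)
        (show ({a} : Finset (Fin n)) ⊆ Finset.univ.erase b by simpa using hab) (by simpa using hk)
        (by rw [Finset.card_erase_of_mem (Finset.mem_univ b)]; simp; omega)
      exact ⟨R, h3, h1 (by simp), fun hb => by simpa using h2 hb⟩
    have hX0 (a b : Fin n) (hab : ¬ (i = a ∧ j = b)) : X a b = 0 := by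
      by_cases ha : i = a
      · obtain ⟨R, hR, hjR, hbR⟩ := hset j b fun h => hab ⟨ha, h⟩
        refine hXS (Finset.univ ×ˢ R) ?_ (fun A hA => mem_permRankLE_of_mem_columns hR.le hA)
          (by simpa using hjR) a b (by simpa using hbR)
        rw [Finset.card_product, hR]; simp [mul_comm]
      · obtain ⟨R, hR, hiR, haR⟩ := hset i a ha
        refine hXS (R ×ˢ Finset.univ) ?_ (fun A hA => mem_permRankLE_of_mem_rows hR.le hA)
          (by simpa using hiR) a b (by simpa using haR)
        rw [Finset.card_product, hR]; simp
    have hXe : X = X i j • single i j 1 := by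
      ext a b
      by_cases hab : i = a ∧ j = b
      · obtain ⟨rfl, rfl⟩ := hab
        simp
      · rw [hX0 a b hab, Matrix.smul_apply, single_apply_of_ne _ _ _ _ _ hab, smul_zero]
    have hXij : X i j ≠ 0 := by
      intro h0
      rw [h0, zero_smul] at hXe
      rw [hXe, map_zero] at hX
      simpa using congrFun (congrFun hX p) q
    refine ⟨(p, q), (X i j)⁻¹, inv_ne_zero hXij, ?_⟩
    rw [hXe, map_smul] at hX
    rw [← inv_smul_smul₀ hXij (T (single i j 1)), hX]
    simp
  choose φ c hc hφ using hexists
  have hinj : Function.Injective fun x : Fin n × Fin n => φ x.1 x.2 := by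
    rintro ⟨i, j⟩ ⟨i', j'⟩ h
    simp only at h
    have h1 : T (c i' j' • single i j 1) = T (c i j • single i' j' 1) := by
      rw [map_smul, map_smul, hφ, hφ, h, smul_single, smul_single, smul_eq_mul, smul_eq_mul,
        mul_comm]
    have h3 := congrFun (congrFun (hT.1 h1) i) j
    by_contra hne
    rw [Matrix.smul_apply, Matrix.smul_apply, single_apply_same,
      single_apply_of_ne _ _ _ _ _ (fun h => hne (by rw [h.1, h.2])), smul_zero, smul_eq_mul,
      mul_one] at h3
    exact hc i' j' h3
  refine ⟨fun x => φ x.1 x.2, c, hinj, hc, fun A i j => ?_⟩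
  have hTA : T A = ∑ a, ∑ b, A a b • single (φ a b).1 (φ a b).2 (c a b) := by
    conv_lhs => rw [matrix_eq_sum_single A]
    simp only [map_sum]
    refine Finset.sum_congr rfl fun a _ => Finset.sum_congr rfl fun b _ => ?_
    rw [← hφ, ← map_smul, smul_single, smul_eq_mul, mul_one]
  rw [hTA]
  simp only [Matrix.sum_apply]
  rw [Finset.sum_eq_single i, Finset.sum_eq_single j]
  · simp [mul_comm]
  · intro b _ hb
    rw [Matrix.smul_apply, single_apply_of_ne, smul_zero]
    exact fun h => hb (Prod.ext_iff.1 (hinj (a₁ := (i, b)) (a₂ := (i, j)) (Prod.ext h.1 h.2))).2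
  · simp
  · intro a _ ha
    refine Finset.sum_eq_zero fun b _ => ?_
    rw [Matrix.smul_apply, single_apply_of_ne, smul_zero]
    exact fun h => ha (Prod.ext_iff.1 (hinj (a₁ := (a, b)) (a₂ := (i, j)) (Prod.ext h.1 h.2))).1
  · simp

/-- If two collinear cells had non-collinear images, those images would extend to `k + 1` cells in
distinct lines. The indicator of the preimage has permanental rank at most `k`, yet its image has a
diagonal minor of size `k + 1` with nonzero diagonal. -/
theorem collinear_of_preserves (hk : 1 ≤ k) (hkn : k < n)
    {T : Matrix (Fin n) (Fin n) F → Matrix (Fin n) (Fin n) F}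
    (hΛ : ∀ A ∈ permRankLE F n k, T A ∈ permRankLE F n k)
    {φ : Fin n × Fin n → Fin n × Fin n} {c : Fin n → Fin n → F} (hφ : Function.Injective φ)
    (hc : ∀ i j, c i j ≠ 0) (hT : ∀ A i j, T A (φ (i, j)).1 (φ (i, j)).2 = c i j * A i j)
    {p q : Fin n × Fin n} (hpq : p.1 = q.1 ∨ p.2 = q.2) :
    (φ p).1 = (φ q).1 ∨ (φ p).2 = (φ q).2 := by
  classical
  by_contra! hne
  obtain ⟨f, hf, hf0, hf1⟩ := exists_injective_zero_last hk hkn hne.1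
  obtain ⟨g, hg, hg0, hg1⟩ := exists_injective_zero_last hk hkn hne.2
  let M : Finset (Fin n × Fin n) := Finset.univ.image fun x => (f x, g x)
  let Q : Finset (Fin n × Fin n) := Finset.univ.filter fun x => φ x ∈ M
  have hQ : Q.card ≤ k + 1 := by
    have h1 : Q.card ≤ M.card :=
      Finset.card_le_card_of_injOn φ (fun x hx => by simpa [Q] using hx) hφ.injOn
    have h2 : M.card ≤ k + 1 := Finset.card_image_le.trans (by simp)
    exact h1.trans h2
  let A : Matrix (Fin n) (Fin n) F := of fun i j => if (i, j) ∈ Q then 1 else 0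
  have hA : A ∈ permRankLE F n k := by
    refine mem_permRankLE_of_collinear hQ (p := p) (q := q) ?_ ?_ (fun h => hne.1 (by rw [h])) hpq
      fun i j hij => if_neg hij
    · simp only [Q, M, Finset.mem_filter, Finset.mem_univ, true_and, Finset.mem_image]
      exact ⟨0, Prod.ext hf0 hg0⟩
    · simp only [Q, M, Finset.mem_filter, Finset.mem_univ, true_and, Finset.mem_image]
      exact ⟨Fin.last k, Prod.ext hf1 hg1⟩
  have h0 := permanent_submatrix_eq_zero (hΛ A hA) (by simp) hf hg
  have hsurj : Function.Surjective φ := Finite.surjective_of_injective hφ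
  have hentry (x y : Fin (k + 1)) : ∃ d : F, d ≠ 0 ∧ T A (f x) (g y) = if x = y then d else 0 := by
    obtain ⟨⟨i, j⟩, hij⟩ := hsurj (f x, g y)
    refine ⟨c i j, hc i j, ?_⟩
    have := hT A i j
    rw [hij] at this
    rw [this]
    by_cases hxy : x = y
    · subst hxy
      have : (i, j) ∈ Q := by simpa [Q, M, hij] using ⟨x, rfl, rfl⟩
      simp [A, this]
    · have : (i, j) ∉ Q := by
        simp only [Q, M, Finset.mem_filter, Finset.mem_univ, true_and, Finset.mem_image, hij]
        rintro ⟨z, hz⟩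
        obtain ⟨h1, h2⟩ := Prod.ext_iff.1 hz
        exact hxy ((hf h1).symm.trans (hg h2))
      simp [A, this, hxy]
  choose d hd hTd using hentry
  have hdiag : (T A).submatrix f g = diagonal fun x => d x x := by
    ext x y
    rw [submatrix_apply, hTd, diagonal_apply]
    split_ifs with h
    · rw [h]
    · rfl
  rw [hdiag, permanent_diagonal] at h0
  exact Finset.prod_ne_zero_iff.2 (fun x _ => hd x x) h0

/-- The coefficients of a monomial map preserving permanental rank at most `k` have vanishing
`2 × 2` minors. -/
theorem coeff_mul_comm_of_preserves (hk : 1 ≤ k) (hkn : k < n)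
    {T : Matrix (Fin n) (Fin n) F → Matrix (Fin n) (Fin n) F}
    (hΛ : ∀ A ∈ permRankLE F n k, T A ∈ permRankLE F n k)
    {σ τ : Equiv.Perm (Fin n)} {c : Fin n → Fin n → F} (hc : ∀ i j, c i j ≠ 0)
    (hT : ∀ A i j, T A (σ i) (τ j) = c i j * A i j) (i i' j j' : Fin n) :
    c i j * c i' j' = c i j' * c i' j := by
  by_cases hi : i = i'
  · subst hi; ring
  by_cases hj : j = j'
  · subst hj; ring
  obtain ⟨f, hf, hf0, hf1⟩ := exists_injective_zero_last hk hkn hi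
  obtain ⟨g, hg, hg0, hg1⟩ := exists_injective_zero_last hk hkn hj
  have h0l : (0 : Fin (k + 1)) ≠ Fin.last k := fun h => by
    have := congrArg Fin.val h
    simp at this
    omega
  -- The block $\begin{pmatrix}1&1\\1&-1\end{pmatrix}$ of permanent zero on the indices `0` and
  -- `Fin.last k`, padded by an identity. Scaling its entries by `c` turns the permanent into a `2 ×
  -- 2` minor of `c`, up to sign and a nonzero factor.
  let B : Matrix (Fin (k + 1)) (Fin (k + 1)) F := of fun x y =>
    if x = y then (if x = Fin.last k then -1 else 1)
    else if (x = 0 ∨ x = Fin.last k) ∧ (y = 0 ∨ y = Fin.last k) then 1 else 0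
  have hBrow (x : Fin (k + 1)) (h0 : x ≠ 0) (h1 : x ≠ Fin.last k) (y : Fin (k + 1)) (hy : y ≠ x) :
      B x y = 0 := by
    simp [B, h0, h1, hy.symm]
  have hB : B.permanent = 0 := by
    rw [permanent_eq_of_two_rows B h0l hBrow]
    simp [B, h0l, h0l.symm]
  obtain ⟨A, hA, hAB⟩ := exists_mem_permRankLE_submatrix_eq hf hg hB
  have h0 := permanent_submatrix_eq_zero (hΛ A hA) (by simp) (σ.injective.comp hf)
    (τ.injective.comp hg)
  have hTA : (T A).submatrix (σ ∘ f) (τ ∘ g) = of fun x y => c (f x) (g y) * B x y := by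
    ext x y
    simp [hT, ← hAB]
  rw [hTA, permanent_eq_of_two_rows _ h0l fun x hx hx' y hy => by simp [hBrow x hx hx' y hy]] at h0
  rcases mul_eq_zero.1 h0 with h | h
  · simp [B, h0l, h0l.symm, hf0, hf1, hg0, hg1] at h
    linear_combination -h
  · refine absurd h (Finset.prod_ne_zero_iff.2 fun x hx => ?_)
    have hx' : x ≠ Fin.last k := (Finset.mem_erase.1 hx).1
    simp [B, hx', hc]

theorem diagonal_mul_permutationMatrix_mul_apply (d₁ d₂ : Fin n → F) (σ₁ σ₂ : Equiv.Perm (Fin n))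
    (A : Matrix (Fin n) (Fin n) F) (i j : Fin n) :
    (diagonal d₁ * permutationMatrix F σ₁ * A * permutationMatrix F σ₂ * diagonal d₂) i j =
      d₁ i * A (σ₁⁻¹ i) (σ₂ j) * d₂ j := by
  have hl (l : Fin n) : (diagonal d₁ * permutationMatrix F σ₁ * A) i l = d₁ i * A (σ₁⁻¹ i) l := by
    rw [Matrix.mul_assoc, diagonal_mul, Matrix.mul_apply]
    simp [permutationMatrix]
  rw [mul_diagonal, Matrix.mul_apply, Finset.sum_eq_single (σ₂ j)]
  · rw [hl]; simp [permutationMatrix]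
  · intro l _ hlj
    have : permutationMatrix F σ₂ l j = 0 := by
      simp only [permutationMatrix, of_apply]
      rw [if_neg]
      rintro rfl
      simp at hlj
    rw [this, mul_zero]
  · simp

theorem diagonal_mul_permutationMatrix_mul_mem (d₁ d₂ : Fin n → F) (σ₁ σ₂ : Equiv.Perm (Fin n))
    {A : Matrix (Fin n) (Fin n) F} (hA : A ∈ permRankLE F n k) :
    diagonal d₁ * permutationMatrix F σ₁ * A * permutationMatrix F σ₂ * diagonal d₂ ∈
      permRankLE F n k := by
  refine mem_permRankLE_of_forall fun r hr f g hf hg => ?_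
  have : (diagonal d₁ * permutationMatrix F σ₁ * A * permutationMatrix F σ₂ *
      diagonal d₂).submatrix f g = of fun x y => d₁ (f x) *
        A.submatrix (⇑σ₁⁻¹ ∘ f) (σ₂ ∘ g) x y * d₂ (g y) := by
    ext x y
    rw [submatrix_apply, diagonal_mul_permutationMatrix_mul_apply]
    rfl
  rw [this, permanent_mul_row_col (A.submatrix (⇑σ₁⁻¹ ∘ f) (σ₂ ∘ g)) (fun x => d₁ (f x))
    (fun y => d₂ (g y)), permanent_submatrix_eq_zero hA (by simpa using hr)
    ((Equiv.injective _).comp hf) (σ₂.injective.comp hg), mul_zero]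

theorem exists_diagonal_of_preserves (hk : 1 ≤ k) (hkn : k < n)
    {T : Matrix (Fin n) (Fin n) F → Matrix (Fin n) (Fin n) F}
    (hΛ : ∀ A ∈ permRankLE F n k, T A ∈ permRankLE F n k)
    {σ τ : Equiv.Perm (Fin n)} {c : Fin n → Fin n → F} (hc : ∀ i j, c i j ≠ 0)
    (hT : ∀ A i j, T A (σ i) (τ j) = c i j * A i j) :
    ∃ d₁ d₂ : Fin n → F, (∀ i, d₁ i ≠ 0) ∧ (∀ i, d₂ i ≠ 0) ∧
      ∀ A, T A = diagonal d₁ * permutationMatrix F σ * A * permutationMatrix F τ⁻¹ *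
        diagonal d₂ := by
  have : NeZero n := ⟨by omega⟩
  -- Vanishing `2 × 2` minors give the factorization $c_{ij} = c_{i0} \cdot c_{0j}/c_{00}$.
  refine ⟨fun i => c (σ⁻¹ i) 0, fun j => c 0 (τ⁻¹ j) / c 0 0, fun i => hc _ _,
    fun j => div_ne_zero (hc _ _) (hc _ _), fun A => ?_⟩
  ext i j
  rw [diagonal_mul_permutationMatrix_mul_apply]
  have h1 := hT A (σ⁻¹ i) (τ⁻¹ j)
  rw [show σ (σ⁻¹ i) = i from σ.apply_symm_apply i,
    show τ (τ⁻¹ j) = j from τ.apply_symm_apply j] at h1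
  have h2 := coeff_mul_comm_of_preserves hk hkn hΛ hc hT (σ⁻¹ i) 0 (τ⁻¹ j) 0
  rw [h1]
  have := hc 0 0
  field_simp
  linear_combination (A (σ⁻¹ i) (τ⁻¹ j)) * h2

end Preservers

theorem theorem1p1 {F : Type*} [Field F] (hF : ringChar F ≠ 2)
    (n k : ℕ) (hn : 3 ≤ n) (hk : 1 ≤ k) (hkn : k ≤ n - 1)
    (T : Matrix (Fin n) (Fin n) F →ₗ[F] Matrix (Fin n) (Fin n) F)
    (hT : Function.Bijective T) :
    T '' permRankLE F n k ⊆ permRankLE F n k ↔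
      ∃ (σ₁ σ₂ : Equiv.Perm (Fin n)) (d₁ d₂ : Fin n → F),
        (∀ i, d₁ i ≠ 0) ∧ (∀ i, d₂ i ≠ 0) ∧
        ((∀ A : Matrix (Fin n) (Fin n) F,
            T A = Matrix.diagonal d₁ * permutationMatrix F σ₁ * A *
              permutationMatrix F σ₂ * Matrix.diagonal d₂) ∨
          (∀ A : Matrix (Fin n) (Fin n) F,
            T A = Matrix.diagonal d₁ * permutationMatrix F σ₁ * A.transpose *
              permutationMatrix F σ₂ * Matrix.diagonal d₂)) := by
  have hkn' : k < n := by omega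
  constructor
  · intro h
    have hΛ (A : Matrix (Fin n) (Fin n) F) (hA : A ∈ permRankLE F n k) :
        T A ∈ permRankLE F n k := h ⟨A, hA, rfl⟩
    obtain ⟨φ, c, hφ, hc, hTφ⟩ :=
      exists_monomial_of_preserves (Ring.two_ne_zero hF) hn hk hkn' hT hΛ
    obtain ⟨σ, τ, hστ | hστ⟩ := eq_prodMap_or_eq_swap_of_collinear (by omega) hφ
      fun p q hpq => collinear_of_preserves hk hkn' hΛ hφ hc hTφ hpq
    · obtain ⟨d₁, d₂, h₁, h₂, hd⟩ := exists_diagonal_of_preserves hk hkn' hΛ hc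
        (σ := σ) (τ := τ) fun A i j => by rw [← hTφ, hστ]
      exact ⟨σ, τ⁻¹, d₁, d₂, h₁, h₂, Or.inl hd⟩
    -- Precomposing with transposition, which preserves permanental rank, reduces to the
    -- untransposed case.
    · obtain ⟨d₁, d₂, h₁, h₂, hd⟩ := exists_diagonal_of_preserves hk hkn'
        (T := fun A => T A.transpose) (fun A hA => hΛ _ (transpose_mem_permRankLE hA))
        (c := fun i j => c j i) (fun i j => hc j i) (σ := σ) (τ := τ) fun A i j => by
          have := hTφ A.transpose j i
          rw [hστ] at this
          exact this
      exact ⟨σ, τ⁻¹, d₁, d₂, h₁, h₂, Or.inr fun A => by simpa using hd A.transpose⟩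
  · rintro ⟨σ₁, σ₂, d₁, d₂, -, -, hd | hd⟩ _ ⟨A, hA, rfl⟩
    · rw [hd]
      exact diagonal_mul_permutationMatrix_mul_mem d₁ d₂ σ₁ σ₂ hA
    · rw [hd]
      exact diagonal_mul_permutationMatrix_mul_mem d₁ d₂ σ₁ σ₂ (transpose_mem_permRankLE hA)
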